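/- Let $k$ be a field, $q$ an indeterminate, $K$ a finite extension of $k(q)$, and $\mathcal O_K$ the integral closure of $k[q]$ in $K$. Let $0\neq P\in\mathcal O_K[x]$ and $$\mathcal A=\mathcal O_K\Big[x,\tfrac1{P(x)},\tfrac1{P(qx)},\tfrac1{P(q^2x)},\dots\Big]\subset K(x),$$ with $\sigma_q f(x)=f(qx)$, $\delta_q f=\frac{\sigma_q f-f}{q-1}$ and $\partial=x\frac{d}{dx}$ (all of which preserve $\mathcal A$). Let $v$ be a finite place of $K$, i.e. a nonzero prime ideal of $\mathcal O_K$ with $q\notin v$; put $k_v=\mathcal O_K/v$, let $q_v$ be the image of $q$ in $k_v$, and let $\mathcal A_v=\mathcal A\otimes_{\mathcal O_K}k_v$ carry the induced operators $\sigma_{q_v},\delta_{q_v},\partial$ (if $q_v=1$, then $\sigma_{q_v}=\mathrm{id}$ and $\delta_{q_v}=x\frac{d}{dx}$). For $(B,C)=(\mathcal A,\mathcal O_K)$ or $(\mathcal A_v,k_v)$, with $\sigma,\delta$ and $h=q-1$, resp. $h=q_v-1$, let $Diff_B$ be the category of finitely generated projective $B$-modules $N$ with an additive map $\Delta:N\to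 N$ such that $\Delta(an)=\sigma(a)\Delta(n)+\delta(a)n$; so $\Sigma=1+h\Delta$ is $\sigma$-semilinear, and $(N,\Delta)$ is a $q$- (resp. $q_v$-) difference module, or a differential module when $q_v=1$. Morphisms are the $B$-linear maps commuting with $\Delta$. The unit object is $(B,\delta)$, tensor products carry $\Delta\otimes1+\Sigma\otimes\Delta$, and a dual is an object $N^\vee$ identified with $\mathrm{Hom}_B(N,B)$ for which the evaluation $N^\vee\otimes N\to B$ is a morphism. The prolongation of $N$ is $F_\partial(N)=B[\partial]_{\le1}\otimes_BN$, with $\partial(an)=a\,\partial(n)+\partial(a)n$ and $\Delta(\partial(n))=\partial(\Delta n)$. For $\mathcal M\in Diff_B$ let $\langle\mathcal M\rangle^{\otimes}$ (resp. $\langle\mathcal M\rangle^{\otimes,\partial}$) be the smallest full subcategory of $Diff_B$ that contains $\mathcal M$ and the unit object and is closed under direct sums, tensor products, duals, quotients in $Diff_B$, and subobjects $W\hookrightarrow N$ in $Diff_B$ with $N/W$ flat over $C$ (no condition if $C$ is a field), and, resp., also under $F_\partial$. The generic Galois group $Gal(\mathcal M,\eta_B)\subset GL(\mathcal M)$ has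 as points with values in a $B$-algebra $S$ the automorphisms of $\mathcal M\otimes_BS$ induced by the tensor automorphisms of the functor $N\mapsto N\otimes_BS$ on $\langle\mathcal M\rangle^{\otimes}$. The parametrized generic Galois group $Gal^\partial(\mathcal M,\eta_B)$ has as points with values in a $\partial$-algebra $S$ over $(B,\partial)$ the automorphisms of $\mathcal M\otimes_BS$ induced by the tensor automorphisms $\lambda$ of $N\mapsto N\otimes_BS$ on $\langle\mathcal M\rangle^{\otimes,\partial}$ with $\lambda_{F_\partial(N)}=F_\partial(\lambda_N)$ for all $N$. Then for every object $\mathcal M$ of $Diff_{\mathcal A}$, inside $GL(\mathcal M\otimes_{\mathcal A}\mathcal A_v)=GL(\mathcal M)\otimes_{\mathcal A}\mathcal A_v$, $$Gal(\mathcal M\otimes_{\mathcal A}\mathcal A_v,\eta_{\mathcal A_v})\subset Gal(\mathcal M,\eta_{\mathcal A})\otimes_{\mathcal A}\mathcal A_v,$$ and, if $k$ has characteristic zero, $$Gal^{\partial}(\mathcal M\otimes_{\mathcal A}\mathcal A_v,\eta_{\mathcal A_v})\subset Gal^{\partial}(\mathcal M,\eta_{\mathcal A})\otimes_{\mathcal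 A}\mathcal A_v .$$ That is, for every $\mathcal A_v$-algebra (resp. every $\partial$-algebra over $\mathcal A_v$) $S$, every $S$-point of the left-hand side is an $S$-point of the group of $\mathcal M$. -/

import Mathlib

open scoped Polynomial TensorProduct

universe u w

noncomputable section

/-! ## Generalized differential rings of `q`-difference type -/

/-- A (commutative) generalized differential ring over `R` of `q`-difference type, together with a
derivation commuting with the structure.  The bimodule `Ω¹` is free of rank one as a right module,
`Ω¹ = dx · B`, with left multiplication `a · dx = dx · σ a` where `σ a = a + h δ a`, and
`d a = dx · δ a`; the Leibniz rule `d (a b) = a (d b) + (d a) b` is `δ_mul`.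
For `h = q - 1` the endomorphism `σ` is the `q`-difference operator and `δ = (σ - 1) / (q - 1)`;
for `h = 0` (that is `q = 1`) `σ` is the identity and `δ` is an ordinary derivation.
The derivation `der` plays the role of `∂ = x d/dx`. -/
structure QDRing (R : Type*) (B : Type*) [CommRing R] [CommRing B] [Algebra R B] where
  h : R
  δ : B →ₗ[R] B
  δ_one : δ 1 = 0
  δ_mul : ∀ a b, δ (a * b) = a * δ b + δ a * b + h • (δ a * δ b)
  der : Derivation R B B
  δ_der : ∀ a, δ (der a) = der (δ a)

namespace QDRing

variable {R B : Type*} [CommRing R] [CommRing B] [Algebra R B]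

/-- The endomorphism `σ = 1 + h δ`. -/
def σ (D : QDRing R B) (a : B) : B := a + D.h • D.δ a

/-- `algebraMap B B'` is a morphism of generalized differential rings, compatible with the
parameter `h` and with the derivations. -/
structure Compat {R' B' : Type*} [CommRing R'] [CommRing B'] [Algebra R' B'] [Algebra B B']
    (D : QDRing R B) (D' : QDRing R' B') : Prop where
  map_h : algebraMap R' B' D'.h = algebraMap B B' (algebraMap R B D.h)
  map_δ : ∀ b, D'.δ (algebraMap B B' b) = algebraMap B B' (D.δ b)
  map_der : ∀ b, D'.der (algebraMap B B' b) = algebraMap B B' (D.der b)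

/-- A `∂`-algebra over `(B, ∂)`: a `B`-algebra `S` with a derivation extending that of `B`. -/
structure DAlg (D : QDRing R B) (S : Type*) [CommRing S] [Algebra B S] where
  der : Derivation ℤ S S
  der_algebraMap : ∀ b, der (algebraMap B S b) = algebraMap B S (D.der b)

/-- Restriction of the base ring of a `∂`-algebra. -/
def DAlg.restrict {R' B' : Type*} [CommRing R'] [CommRing B'] [Algebra R' B'] [Algebra B B']
    {D : QDRing R B} {D' : QDRing R' B'} (c : Compat D D') {S : Type*} [CommRing S]
    [Algebra B S] [Algebra B' S] [IsScalarTower B B' S] (E : D'.DAlg S) : D.DAlg S where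
  der := E.der
  der_algebraMap b := by
    rw [IsScalarTower.algebraMap_apply B B' S, E.der_algebraMap, c.map_der,
      ← IsScalarTower.algebraMap_apply]

end QDRing

/-! ## Modules with connection -/

/-- Objects of `Diff_B`: finitely generated projective `B`-modules `M` with a connection
`∇ m = dx · Δ m`.  The rule `∇ (a m) = a ∇ m + d a ⊗ m` is `leibniz`.
Then `Σ = 1 + h Δ` is `σ`-semilinear; when `h = q - 1` is not a zero divisor, `Δ` is
`(Σ - 1) / (q - 1)`; when `h = 0`, the pair `(M, Δ)` is a differential module. -/
structure DMod {R : Type*} {B : Type u} [CommRing R] [CommRing B] [Algebra R B]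
    (D : QDRing R B) where
  carrier : Type u
  [addCommGroup : AddCommGroup carrier]
  [module : Module B carrier]
  [finite : Module.Finite B carrier]
  [projective : Module.Projective B carrier]
  Δ : carrier →+ carrier
  leibniz : ∀ (a : B) (m : carrier), Δ (a • m) = D.σ a • Δ m + D.δ a • m

namespace DMod

variable {R : Type*} {B : Type u} [CommRing R] [CommRing B] [Algebra R B] {D : QDRing R B}

instance : CoeSort (DMod D) (Type u) := ⟨DMod.carrier⟩

attribute [instance] DMod.addCommGroup DMod.module DMod.finite DMod.projective

/-- The semilinear operator `Σ = 1 + h Δ`. -/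
def Sig (N : DMod D) (n : N) : N := n + algebraMap R B D.h • N.Δ n

/-- Horizontal morphisms. -/
structure Hom (N N' : DMod D) where
  toLin : N →ₗ[B] N'
  horiz : ∀ n, toLin (N.Δ n) = N'.Δ (toLin n)

theorem σ_eq (a : B) : D.σ a = a + algebraMap R B D.h * D.δ a := by
  rw [QDRing.σ, Algebra.smul_def]

theorem δ_mul' (a b : B) : D.δ (a * b) = D.σ a * D.δ b + D.δ a * b := by
  rw [σ_eq, D.δ_mul, Algebra.smul_def]; ring

theorem σ_mul (a b : B) : D.σ (a * b) = D.σ a * D.σ b := by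
  simp only [σ_eq, D.δ_mul, Algebra.smul_def]; ring

theorem _root_.QDRing.Compat.map_σ {R' B' : Type*} [CommRing R'] [CommRing B'] [Algebra R' B']
    [Algebra B B'] {D' : QDRing R' B'} (c : QDRing.Compat D D') (b : B) :
    D'.σ (algebraMap B B' b) = algebraMap B B' (D.σ b) := by
  simp only [QDRing.σ, Algebra.smul_def, c.map_δ, c.map_h, map_add, map_mul]

/-- The unit object `(B, δ)`. -/
abbrev unit (D : QDRing R B) : DMod D where
  carrier := B
  Δ := D.δ.toAddMonoidHom
  leibniz a m := by simp [δ_mul']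

/-- Direct sums. -/
abbrev prod (N N' : DMod D) : DMod D where
  carrier := N × N'
  Δ := N.Δ.prodMap N'.Δ
  leibniz a m := by ext <;> simp [leibniz]

/-- The connection `Δ ⊗ 1 + Σ ⊗ Δ` on a tensor product, so that its operator `Σ` is `Σ ⊗ Σ`. -/
def tensorΔ (N N' : DMod D) : N ⊗[B] N' →+ N ⊗[B] N' :=
  TensorProduct.liftAddHom
    { toFun := fun n =>
        { toFun := fun n' => N.Δ n ⊗ₜ[B] n' + N.Sig n ⊗ₜ[B] N'.Δ n'
          map_zero' := by simp
          map_add' := fun x y => by simp only [map_add, TensorProduct.tmul_add]; abel }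
      map_zero' := by ext; simp [Sig]
      map_add' := fun x y => by
        ext n'
        simp only [Sig, map_add, TensorProduct.add_tmul, smul_add, AddMonoidHom.coe_mk,
          ZeroHom.coe_mk, AddMonoidHom.add_apply]
        abel }
    (fun r n n' => by
      simp only [Sig, leibniz, σ_eq, AddMonoidHom.coe_mk, ZeroHom.coe_mk, TensorProduct.add_tmul,
        TensorProduct.tmul_add, TensorProduct.tmul_smul, smul_add, ← TensorProduct.smul_tmul']
      module)

@[simp] theorem tensorΔ_tmul (N N' : DMod D) (n : N) (n' : N') :
    tensorΔ N N' (n ⊗ₜ n') = N.Δ n ⊗ₜ n' + N.Sig n ⊗ₜ N'.Δ n' := rfl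

/-- Tensor products. -/
abbrev tensor (N N' : DMod D) : DMod D where
  carrier := N ⊗[B] N'
  Δ := tensorΔ N N'
  leibniz a m := by
    induction m with
    | zero => simp
    | add x y hx hy => simp only [smul_add, map_add, hx, hy]; abel
    | tmul n n' =>
      simp only [TensorProduct.smul_tmul', tensorΔ_tmul, Sig, leibniz, σ_eq,
        TensorProduct.add_tmul, smul_add]
      simp only [← TensorProduct.smul_tmul']
      module

/-- `N'` is a dual of `N`: it is identified with `Hom_B (N, B)` in such a way that the evaluation
pairing `N' ⊗ N → B` is horizontal, that is `δ ⟨φ, n⟩ = ⟨Δ φ, Σ n⟩ + ⟨φ, Δ n⟩`. -/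
def IsDual (N N' : DMod D) : Prop :=
  ∃ e : N' ≃ₗ[B] Module.Dual B N, ∀ (φ : N') (n : N),
    D.δ (e φ n) = e (N'.Δ φ) (N.Sig n) + e φ (N.Δ n)

/-! ### Prolongation -/

/-- The underlying group of `B[∂]_{≤ 1} ⊗_B N`; the pair `(a, b)` stands for `a + ∂(b)`. -/
def Prol (_D : QDRing R B) (N : Type u) : Type u := N × N

namespace Prol

variable (D) (N : Type u) [AddCommGroup N] [Module B N]

instance : AddCommGroup (Prol D N) := inferInstanceAs (AddCommGroup (N × N))

/-- The left module structure given by `λ ∂(b) = ∂(λ b) - ∂(λ) b`. -/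
instance : Module B (Prol D N) where
  smul r z := (r • z.1 - D.der r • z.2, r • z.2)
  one_smul z := Prod.ext (show (1 : B) • z.1 - D.der 1 • z.2 = z.1 by simp)
    (show (1 : B) • z.2 = z.2 by simp)
  mul_smul r s z := Prod.ext
    (show (r * s) • z.1 - D.der (r * s) • z.2
        = r • (s • z.1 - D.der s • z.2) - D.der r • s • z.2 by
      simp only [Derivation.leibniz, smul_eq_mul]; module)
    (show (r * s) • z.2 = r • s • z.2 by module)
  smul_zero r := Prod.ext (show r • (0 : N) - D.der r • (0 : N) = 0 by simp)
    (show r • (0 : N) = 0 by simp)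
  smul_add r y z := Prod.ext
    (show r • (y.1 + z.1) - D.der r • (y.2 + z.2)
        = (r • y.1 - D.der r • y.2) + (r • z.1 - D.der r • z.2) by module)
    (show r • (y.2 + z.2) = r • y.2 + r • z.2 by module)
  add_smul r s z := Prod.ext
    (show (r + s) • z.1 - D.der (r + s) • z.2
        = (r • z.1 - D.der r • z.2) + (s • z.1 - D.der s • z.2) by
      simp only [map_add]; module)
    (show (r + s) • z.2 = r • z.2 + s • z.2 by module)
  zero_smul z := Prod.ext (show (0 : B) • z.1 - D.der 0 • z.2 = 0 by simp)
    (show (0 : B) • z.2 = 0 by simp)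

variable {D N}

theorem smul_def (r : B) (z : Prol D N) :
    r • z = ((r • z.1 - D.der r • z.2, r • z.2) : N × N) := rfl

variable (D N)

/-- The inclusion `n ↦ 1 ⊗ n`. -/
def incl : N →ₗ[B] Prol D N where
  toFun n := ((n, 0) : N × N)
  map_add' x y := Prod.ext rfl (show (0 : N) = 0 + 0 by simp)
  map_smul' r x := Prod.ext (show r • x = r • x - D.der r • (0 : N) by simp)
    (show (0 : N) = r • (0 : N) by simp)

/-- The additive map `n ↦ ∂(n) = ∂ ⊗ n`. -/
def del : N →+ Prol D N where
  toFun n := ((0, n) : N × N)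
  map_zero' := rfl
  map_add' x y := Prod.ext (show (0 : N) = 0 + 0 by simp) rfl

/-- The projection `a + ∂(b) ↦ b`. -/
def proj : Prol D N →ₗ[B] N where
  toFun z := z.2
  map_add' _ _ := rfl
  map_smul' _ _ := rfl

theorem del_smul (r : B) (n : N) : del D N (r • n) = r • del D N n + D.der r • incl D N n :=
  Prod.ext
    (show (0 : N) = (r • (0 : N) - D.der r • n) + (D.der r • n - D.der (D.der r) • (0 : N)) by simp)
    (show r • n = r • n + D.der r • (0 : N) by simp)

theorem exists_equiv [Module.Projective B N] : Nonempty ((N × N) ≃ₗ[B] Prol D N) := by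
  obtain ⟨s, hs⟩ := Module.projective_lifting_property (proj D N) LinearMap.id
    (fun n => ⟨del D N n, rfl⟩)
  have hs' : ∀ n, (s n).2 = n := fun n => LinearMap.congr_fun hs n
  refine ⟨LinearEquiv.ofBijective ((incl D N).coprod s) ⟨?_, ?_⟩⟩
  · rw [← LinearMap.ker_eq_bot, LinearMap.ker_eq_bot']
    rintro ⟨a, b⟩ hab
    have h2 : (0 : N) + (s b).2 = 0 := congrArg Prod.snd hab
    have hb : b = 0 := by simpa [hs'] using h2
    subst hb
    have h1 : a + (s 0).1 = 0 := congrArg Prod.fst hab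
    rw [map_zero] at h1
    have : a + 0 = 0 := h1
    simpa using this
  · intro z
    refine ⟨(z.1 - (s z.2).1, z.2), ?_⟩
    exact Prod.ext (show z.1 - (s z.2).1 + (s z.2).1 = z.1 by simp)
      (show (0 : N) + (s z.2).2 = z.2 by simp [hs'])

instance [Module.Projective B N] : Module.Projective B (Prol D N) :=
  Module.Projective.of_equiv (exists_equiv D N).some

instance [Module.Projective B N] [Module.Finite B N] : Module.Finite B (Prol D N) :=
  Module.Finite.equiv (exists_equiv D N).some

end Prol

/-- The prolongation functor `F_∂` on objects: `Δ (a + ∂(b)) = Δ a + ∂(Δ b)`. -/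
abbrev prolong (N : DMod D) : DMod D where
  carrier := Prol D N
  Δ := N.Δ.prodMap N.Δ
  leibniz a z := Prod.ext
    (show N.Δ (a • z.1 - D.der a • z.2)
        = (D.σ a • N.Δ z.1 - D.der (D.σ a) • N.Δ z.2) + (D.δ a • z.1 - D.der (D.δ a) • z.2) by
      simp only [map_sub, leibniz, QDRing.σ, map_add, D.δ_der, Derivation.map_smul]
      module)
    (show N.Δ (a • z.2) = D.σ a • N.Δ z.2 + D.δ a • z.2 from N.leibniz a z.2)

/-! ### The tensor categories generated by an object -/

/-- The cokernel of `f` is flat over the base ring `R`. -/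
def Hom.FlatCoker {W N : DMod D} (f : Hom W N) : Prop :=
  letI : Module R (N ⧸ LinearMap.range f.toLin) := Module.compHom _ (algebraMap R B)
  Module.Flat R (N ⧸ LinearMap.range f.toLin)

/-- The objects of the full subcategory `⟨M⟩^⊗` of `Diff_B` generated by `M` (for `p = False`),
and of `⟨M⟩^{⊗,∂}` (for `p = True`): the closure of `M` under direct sums, tensor products,
duals, subobjects and quotients, and in the second case also under prolongation.
Subobjects are the submodules with connection that are `R`-saturated, i.e. whose cokernel is
`R`-flat; this is no condition when `R` is a field, and over a Dedekind ring `R` it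
says that the quotient has no `R`-torsion. -/
inductive Gen (p : Prop) (M : DMod D) : DMod D → Prop
  | base : Gen p M M
  | unit : Gen p M (unit D)
  | prod {N N' : DMod D} : Gen p M N → Gen p M N' → Gen p M (N.prod N')
  | tensor {N N' : DMod D} : Gen p M N → Gen p M N' → Gen p M (N.tensor N')
  | dual {N N' : DMod D} : Gen p M N → IsDual N N' → Gen p M N'
  | sub {N W : DMod D} (f : Hom W N) : Gen p M N → Function.Injective f.toLin → f.FlatCoker →
      Gen p M W
  | quot {N Q : DMod D} (f : Hom N Q) : Gen p M N → Function.Surjective f.toLin → Gen p M Q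
  | prolong {N : DMod D} : p → Gen p M N → Gen p M N.prolong

/-! ### Tensor automorphisms of the forgetful functor -/

variable (S : Type w) [CommRing S] [Algebra B S]

/-- `S`-valued points of `Aut^⊗` of the forgetful functor restricted to `⟨M⟩^⊗`
(resp. `⟨M⟩^{⊗,∂}`): families of `S`-linear automorphisms of `S ⊗ N`, natural in `N` and
compatible with the unit object and with tensor products. -/
structure TensorAut (p : Prop) (M : DMod D) where
  app : ∀ N : DMod D, Gen p M N → (S ⊗[B] N) ≃ₗ[S] (S ⊗[B] N)
  natural : ∀ {N N' : DMod D} (hN : Gen p M N) (hN' : Gen p M N') (f : Hom N N') (z : S ⊗[B] N),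
    app N' hN' (f.toLin.baseChange S z) = f.toLin.baseChange S (app N hN z)
  app_unit : ∀ z : S ⊗[B] unit D, app (unit D) .unit z = z
  app_tensor : ∀ {N N' : DMod D} (hN : Gen p M N) (hN' : Gen p M N') (z : S ⊗[B] (N ⊗[B] N')),
    TensorProduct.AlgebraTensorModule.distribBaseChange B S N N'
        (app (N.tensor N') (.tensor hN hN') z) =
      TensorProduct.map (app N hN).toLinearMap (app N' hN').toLinearMap
        (TensorProduct.AlgebraTensorModule.distribBaseChange B S N N' z)

namespace TensorAut

variable {S} {p : Prop} {M : DMod D}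

/-- The identity. -/
def one : TensorAut S p M where
  app _ _ := 1
  natural _ _ _ _ := rfl
  app_unit _ := rfl
  app_tensor _ _ z := by
    change _ = TensorProduct.map LinearMap.id LinearMap.id _
    rw [TensorProduct.map_id]; rfl

/-- Composition. -/
def mul (l l' : TensorAut S p M) : TensorAut S p M where
  app N hN := l.app N hN * l'.app N hN
  natural hN hN' f z := by simp only [LinearEquiv.mul_apply, l.natural hN hN', l'.natural hN hN']
  app_unit z := by simp only [LinearEquiv.mul_apply, l.app_unit, l'.app_unit]
  app_tensor hN hN' z := by
    refine (l.app_tensor hN hN' _).trans ?_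
    refine (congrArg _ (l'.app_tensor hN hN' z)).trans ?_
    rw [← LinearMap.comp_apply, ← TensorProduct.map_comp]
    rfl

/-- Inverse. -/
def inv (l : TensorAut S p M) : TensorAut S p M where
  app N hN := (l.app N hN).symm
  natural hN hN' f z := by
    rw [LinearEquiv.symm_apply_eq, l.natural hN hN', LinearEquiv.apply_symm_apply]
  app_unit z := by rw [LinearEquiv.symm_apply_eq, l.app_unit]
  app_tensor hN hN' z := by
    obtain ⟨y, rfl⟩ := (l.app _ (.tensor hN hN')).surjective z
    rw [l.app_tensor hN hN', LinearEquiv.symm_apply_apply, ← LinearMap.comp_apply,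
      ← TensorProduct.map_comp]
    simp

end TensorAut

/-- The group of `S`-points of the generic Galois group `Gal(M, η_B)`, inside
`GL(M)(S) = Aut_S (S ⊗ M)`. -/
def Gal (M : DMod D) : Subgroup ((S ⊗[B] M) ≃ₗ[S] (S ⊗[B] M)) where
  carrier := {g | ∃ l : TensorAut S False M, l.app M .base = g}
  one_mem' := ⟨.one, rfl⟩
  mul_mem' := by
    rintro _ _ ⟨l, rfl⟩ ⟨l', rfl⟩
    exact ⟨l.mul l', rfl⟩
  inv_mem' := by
    rintro _ ⟨l, rfl⟩
    exact ⟨l.inv, rfl⟩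

variable {S}

/-- The map `∂ : S ⊗ N → F_∂(S ⊗ N) = S ⊗ F_∂(N)`, `∂ (s ⊗ n) = ∂(s) ⊗ n + s ⊗ ∂(n)`. -/
def delS (E : D.DAlg S) (N : DMod D) : S ⊗[B] N →+ S ⊗[B] Prol D N :=
  TensorProduct.liftAddHom
    { toFun := fun s =>
        { toFun := fun n => E.der s ⊗ₜ[B] Prol.incl D N n + s ⊗ₜ[B] Prol.del D N n
          map_zero' := by simp
          map_add' := fun x y => by simp only [map_add, TensorProduct.tmul_add]; abel }
      map_zero' := by ext; simp
      map_add' := fun x y => by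
        ext n
        simp only [map_add, TensorProduct.add_tmul, AddMonoidHom.coe_mk,
          ZeroHom.coe_mk, AddMonoidHom.add_apply]
        abel }
    (fun r s n => by
      simp only [AddMonoidHom.coe_mk, ZeroHom.coe_mk, Prol.del_smul, map_smul,
        TensorProduct.tmul_add, TensorProduct.tmul_smul, TensorProduct.smul_tmul',
        Algebra.smul_def r s, Algebra.smul_def r (E.der s), Algebra.smul_def (D.der r) s,
        Derivation.leibniz, E.der_algebraMap, smul_eq_mul, TensorProduct.add_tmul]
      rw [mul_comm s]
      abel)

/-- The group of `S`-points of the parametrized generic Galois group `Gal^∂(M, η_B)`, for a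
`∂`-algebra `S` over `B`: the tensor automorphisms `l` of the forgetful functor on `⟨M⟩^{⊗,∂}`
with `l_{F_∂(N)} = F_∂(l_N)`. On `S ⊗ N ⊆ S ⊗ F_∂(N)` the latter holds by naturality, so that it
amounts to the condition on `∂(S ⊗ N)` imposed here. -/
def GalDer (E : D.DAlg S) (M : DMod D) : Subgroup ((S ⊗[B] M) ≃ₗ[S] (S ⊗[B] M)) where
  carrier := {g | ∃ l : TensorAut S True M, l.app M .base = g ∧
    ∀ (N : DMod D) (hN : Gen True M N) (z : S ⊗[B] N),
      l.app N.prolong (.prolong trivial hN) (delS E N z) = delS E N (l.app N hN z)}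
  one_mem' := ⟨.one, rfl, fun _ _ _ => rfl⟩
  mul_mem' := by
    rintro _ _ ⟨l, rfl, h⟩ ⟨l', rfl, h'⟩
    refine ⟨l.mul l', rfl, fun N hN z => ?_⟩
    simp only [TensorAut.mul, LinearEquiv.mul_apply]
    rw [h' N hN, h N hN]
  inv_mem' := by
    rintro _ ⟨l, rfl, h⟩
    refine ⟨l.inv, rfl, fun N hN z => ?_⟩
    simp only [TensorAut.inv]
    rw [LinearEquiv.symm_apply_eq, h N hN, LinearEquiv.apply_symm_apply]

/-! ### Base change -/

section BaseChange

variable {R' : Type*} {B' : Type u} [CommRing R'] [CommRing B'] [Algebra R' B'] [Algebra B B']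
  {D' : QDRing R' B'}

/-- The connection on `B' ⊗ N`: `Δ (b ⊗ n) = δ b ⊗ n + σ b ⊗ Δ n`. -/
def baseChangeΔ (c : QDRing.Compat D D') (N : DMod D) : B' ⊗[B] N →+ B' ⊗[B] N :=
  TensorProduct.liftAddHom
    { toFun := fun b =>
        { toFun := fun n => D'.δ b ⊗ₜ[B] n + D'.σ b ⊗ₜ[B] N.Δ n
          map_zero' := by simp
          map_add' := fun x y => by simp only [map_add, TensorProduct.tmul_add]; abel }
      map_zero' := by ext; simp [QDRing.σ]
      map_add' := fun x y => by
        ext n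
        simp only [map_add, TensorProduct.add_tmul, AddMonoidHom.coe_mk, QDRing.σ, smul_add,
          ZeroHom.coe_mk, AddMonoidHom.add_apply]
        abel }
    (fun r b n => by
      simp only [AddMonoidHom.coe_mk, ZeroHom.coe_mk, leibniz, TensorProduct.tmul_add,
        TensorProduct.tmul_smul, Algebra.smul_def r b, δ_mul', σ_mul, c.map_δ, c.map_σ]
      have key : algebraMap B B' (D.σ r) * D'.δ b + algebraMap B B' (D.δ r) * b
          = r • D'.δ b + D.δ r • D'.σ b := by
        simp only [σ_eq, Algebra.smul_def, c.map_h, map_add, map_mul]; ring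
      rw [key, ← Algebra.smul_def, TensorProduct.add_tmul]
      simp only [TensorProduct.smul_tmul']
      abel)

@[simp] theorem baseChangeΔ_tmul (c : QDRing.Compat D D') (N : DMod D) (b : B') (n : N) :
    baseChangeΔ c N (b ⊗ₜ n) = D'.δ b ⊗ₜ n + D'.σ b ⊗ₜ N.Δ n := rfl

/-- The base change functor `Diff_B → Diff_{B'}` on objects. -/
abbrev baseChange (c : QDRing.Compat D D') (N : DMod D) : DMod D' where
  carrier := B' ⊗[B] N
  Δ := baseChangeΔ c N
  leibniz a m := by
    induction m with
    | zero => simp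
    | add x y hx hy => simp only [smul_add, map_add, hx, hy]; abel
    | tmul b n =>
      simp only [TensorProduct.smul_tmul', baseChangeΔ_tmul, smul_eq_mul, δ_mul', σ_mul,
        TensorProduct.add_tmul, smul_add]
      abel

/-- The identification `GL(M)(S) = GL(M ⊗ B')(S)` for a `B'`-algebra `S`: an automorphism of
`S ⊗_{B'} (B' ⊗_B M)` viewed as an automorphism of `S ⊗_B M`. -/
def descend (c : QDRing.Compat D D') (M : DMod D) {S : Type w} [CommRing S] [Algebra B S]
    [Algebra B' S] [IsScalarTower B B' S]
    (g : (S ⊗[B'] (M.baseChange c)) ≃ₗ[S] (S ⊗[B'] (M.baseChange c))) :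
    (S ⊗[B] M) ≃ₗ[S] (S ⊗[B] M) :=
  (TensorProduct.AlgebraTensorModule.cancelBaseChange B B' S S M).symm ≪≫ₗ g ≪≫ₗ
    TensorProduct.AlgebraTensorModule.cancelBaseChange B B' S S M

end BaseChange

end DMod

/-! ## Reduction modulo an ideal of constants -/

namespace QDRing

/-- `B_{R'} = B ⊗_R R'`. -/
def Red (R R' : Type u) (B : Type u) [CommRing R] [CommRing R'] [CommRing B] [Algebra R R']
    [Algebra R B] : Type u := R' ⊗[R] B

section Red

variable (R R' : Type u) (B : Type u) [CommRing R] [CommRing R'] [CommRing B] [Algebra R R']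
  [Algebra R B]

instance : CommRing (Red R R' B) := inferInstanceAs (CommRing (R' ⊗[R] B))
instance : Algebra R' (Red R R' B) := inferInstanceAs (Algebra R' (R' ⊗[R] B))
instance : Algebra B (Red R R' B) :=
  (Algebra.TensorProduct.includeRight : B →ₐ[R] R' ⊗[R] B).toRingHom.toAlgebra

variable {R B}

/-- The derivation `∂ ⊗ 1`. -/
def redDer (D : QDRing R B) : Derivation R' (Red R R' B) (Red R R' B) :=
  Derivation.mk' (LinearMap.baseChange R' (D.der : B →ₗ[R] B) : R' ⊗[R] B →ₗ[R'] R' ⊗[R] B)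
    (by
      change ∀ a b : R' ⊗[R] B, LinearMap.baseChange R' (D.der : B →ₗ[R] B) (a * b) =
        a * LinearMap.baseChange R' (D.der : B →ₗ[R] B) b +
          b * LinearMap.baseChange R' (D.der : B →ₗ[R] B) a
      intro a b
      induction a with
      | zero => simp
      | add x y hx hy => simp only [add_mul, mul_add, map_add, hx, hy]; ring
      | tmul r x =>
        induction b with
        | zero => simp
        | add x y hx hy => simp only [add_mul, mul_add, map_add, hx, hy]; ring
        | tmul s y =>
          simp [TensorProduct.tmul_add, mul_comm s r])

/-- The generalized differential ring `(B ⊗_R R', δ ⊗ 1, ∂ ⊗ 1)` over `R'`. -/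
def red (D : QDRing R B) : QDRing R' (Red R R' B) where
  h := algebraMap R R' D.h
  δ := (LinearMap.baseChange R' D.δ : R' ⊗[R] B →ₗ[R'] R' ⊗[R] B)
  δ_one := by
    change LinearMap.baseChange R' D.δ ((1 : R') ⊗ₜ[R] (1 : B)) = 0
    simp [D.δ_one]
  δ_mul := by
    change ∀ a b : R' ⊗[R] B, LinearMap.baseChange R' D.δ (a * b) =
      a * LinearMap.baseChange R' D.δ b + LinearMap.baseChange R' D.δ a * b +
        algebraMap R R' D.h • (LinearMap.baseChange R' D.δ a * LinearMap.baseChange R' D.δ b)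
    intro a b
    induction a with
    | zero => simp
    | add x y hx hy => simp only [add_mul, map_add, hx, hy, smul_add]; ring
    | tmul r x =>
      induction b with
      | zero => simp
      | add x y hx hy => simp only [mul_add, map_add, hx, hy, smul_add]; ring
      | tmul s y =>
        simp [TensorProduct.tmul_add, D.δ_mul, algebraMap_smul]
  der := D.redDer R'
  δ_der := by
    change ∀ a : R' ⊗[R] B,
      LinearMap.baseChange R' D.δ (LinearMap.baseChange R' (D.der : B →ₗ[R] B) a) =
      LinearMap.baseChange R' (D.der : B →ₗ[R] B) (LinearMap.baseChange R' D.δ a)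
    intro a
    induction a with
    | zero => simp
    | add x y hx hy => simp only [map_add, hx, hy]
    | tmul r x => simp [D.δ_der]

/-- The projection `B → B ⊗_R R'` is a morphism of generalized differential rings. -/
theorem red_compat (D : QDRing R B) : Compat D (D.red R') where
  map_h := by
    change (algebraMap R R' D.h) ⊗ₜ[R] (1 : B) = (1 : R') ⊗ₜ[R] (algebraMap R B D.h)
    rw [Algebra.algebraMap_eq_smul_one, Algebra.algebraMap_eq_smul_one, TensorProduct.smul_tmul]
  map_δ b := by
    change LinearMap.baseChange R' D.δ ((1 : R') ⊗ₜ[R] b) = (1 : R') ⊗ₜ[R] D.δ b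
    simp
  map_der b := by
    change LinearMap.baseChange R' (D.der : B →ₗ[R] B) ((1 : R') ⊗ₜ[R] b) = (1 : R') ⊗ₜ[R] D.der b
    simp

end Red

end QDRing

/-! ## Rational functions -/

namespace QRat

section Rat

variable (K : Type u) [Field K]

theorem algebraMap_eq_aeval (p : K[X]) :
    algebraMap K[X] (RatFunc K) p = Polynomial.aeval (RatFunc.X : RatFunc K) p := by
  have : IsScalarTower.toAlgHom K K[X] (RatFunc K) = Polynomial.aeval (RatFunc.X : RatFunc K) :=
    Polynomial.algHom_ext (by simp)
  exact DFunLike.congr_fun this p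

theorem fst_aeval (p : K[X]) :
    (Polynomial.aeval (TrivSqZeroExt.inl RatFunc.X + TrivSqZeroExt.inr RatFunc.X :
      TrivSqZeroExt (RatFunc K) (RatFunc K)) p).fst = algebraMap K[X] (RatFunc K) p := by
  have : (TrivSqZeroExt.fstHom K (RatFunc K) (RatFunc K)).comp
      (Polynomial.aeval (TrivSqZeroExt.inl RatFunc.X + TrivSqZeroExt.inr RatFunc.X))
      = Polynomial.aeval (RatFunc.X : RatFunc K) :=
    Polynomial.algHom_ext (by simp)
  rw [algebraMap_eq_aeval]
  exact DFunLike.congr_fun this p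

/-- The ring homomorphism `f ↦ f(x + ε x) = f(x) + ε x f'(x)` to the dual numbers. -/
def dualLift : RatFunc K →+* TrivSqZeroExt (RatFunc K) (RatFunc K) :=
  IsLocalization.lift (M := nonZeroDivisors K[X])
    (g := (Polynomial.aeval (TrivSqZeroExt.inl RatFunc.X + TrivSqZeroExt.inr RatFunc.X :
      TrivSqZeroExt (RatFunc K) (RatFunc K)) : K[X] →ₐ[K] _).toRingHom)
    (by
      intro y
      rw [TrivSqZeroExt.isUnit_iff_isUnit_fst, isUnit_iff_ne_zero]
      have h := fst_aeval K (y : K[X])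
      refine fun h0 => nonZeroDivisors.ne_zero y.2 ?_
      exact (map_eq_zero_iff _ (IsFractionRing.injective K[X] (RatFunc K))).1 (h.symm.trans h0))

theorem dualLift_algebraMap (p : K[X]) : dualLift K (algebraMap K[X] (RatFunc K) p) =
    Polynomial.aeval (TrivSqZeroExt.inl RatFunc.X + TrivSqZeroExt.inr RatFunc.X) p :=
  IsLocalization.lift_eq _ _

theorem fst_dualLift (f : RatFunc K) : (dualLift K f).fst = f := by
  have : (TrivSqZeroExt.fstHom K (RatFunc K) (RatFunc K)).toRingHom.comp (dualLift K)
      = RingHom.id _ := by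
    refine IsLocalization.ringHom_ext (nonZeroDivisors K[X]) (RingHom.ext fun p => ?_)
    change (dualLift K (algebraMap K[X] (RatFunc K) p)).fst = algebraMap K[X] (RatFunc K) p
    rw [dualLift_algebraMap, fst_aeval]
  exact DFunLike.congr_fun this f

/-- The derivation `∂ = x d/dx` of `K(x)`. -/
def theta : Derivation K (RatFunc K) (RatFunc K) :=
  Derivation.mk'
    { toFun := fun f => (dualLift K f).snd
      map_add' := fun f g => by simp
      map_smul' := fun c f => by
        have hc : dualLift K (algebraMap K (RatFunc K) c) =
            algebraMap K (TrivSqZeroExt (RatFunc K) (RatFunc K)) c := by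
          rw [IsScalarTower.algebraMap_apply K K[X] (RatFunc K), dualLift_algebraMap]
          simp
        rw [Algebra.smul_def c f, map_mul, hc, ← Algebra.smul_def]
        rfl }
    (fun f g => by
      change (dualLift K (f * g)).snd = f • (dualLift K g).snd + g • (dualLift K f).snd
      rw [map_mul, TrivSqZeroExt.snd_mul, fst_dualLift, fst_dualLift, op_smul_eq_smul])

theorem theta_X : theta K RatFunc.X = RatFunc.X := by
  change (dualLift K RatFunc.X).snd = RatFunc.X
  rw [← RatFunc.algebraMap_X, dualLift_algebraMap]
  simp

variable {K}

theorem comp_mem_nonZeroDivisors {q : K} (hq : q ≠ 0) :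
    nonZeroDivisors K[X] ≤ (nonZeroDivisors K[X]).comap
      (Polynomial.aeval (Polynomial.C q * Polynomial.X) : K[X] →ₐ[K] K[X]) := by
  refine nonZeroDivisors_le_comap_nonZeroDivisors_of_injective _ ?_
  let _ := invertibleOfNonzero hq
  have h := (Polynomial.algEquivCMulXAddC q 0).injective
  intro a b hab
  apply h
  simpa [Polynomial.algEquivCMulXAddC] using hab

/-- The `q`-difference operator `f(x) ↦ f(qx)` of `K(x)`. -/
def sigma {q : K} (hq : q ≠ 0) : RatFunc K →ₐ[K] RatFunc K :=
  RatFunc.mapAlgHom (Polynomial.aeval (Polynomial.C q * Polynomial.X))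
    (comp_mem_nonZeroDivisors hq)

theorem sigma_algebraMap {q : K} (hq : q ≠ 0) (p : K[X]) :
    sigma hq (algebraMap K[X] (RatFunc K) p) =
      algebraMap K[X] (RatFunc K) (Polynomial.aeval (Polynomial.C q * Polynomial.X) p) := by
  have := RatFunc.map_apply_div (Polynomial.aeval (Polynomial.C q * Polynomial.X) : K[X] →ₐ[K] K[X])
    (comp_mem_nonZeroDivisors hq) p 1
  simpa [sigma, RatFunc.coe_mapAlgHom_eq_coe_map] using this

theorem sigma_X {q : K} (hq : q ≠ 0) :
    sigma hq RatFunc.X = algebraMap K (RatFunc K) q * RatFunc.X := by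
  rw [← RatFunc.algebraMap_X, sigma_algebraMap]
  simp [RatFunc.algebraMap_C]

theorem theta_sigma {q : K} (hq : q ≠ 0) (f : RatFunc K) :
    theta K (sigma hq f) = sigma hq (theta K f) := by
  have hpoly : ∀ p : K[X], theta K (sigma hq (algebraMap K[X] (RatFunc K) p))
      = sigma hq (theta K (algebraMap K[X] (RatFunc K) p)) := by
    intro p
    rw [algebraMap_eq_aeval, ← Polynomial.aeval_algHom_apply, Derivation.map_aeval,
      Derivation.map_aeval, sigma_X, smul_eq_mul, smul_eq_mul, map_mul (sigma hq), theta_X, sigma_X,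
      ← Polynomial.aeval_algHom_apply, sigma_X, ← Algebra.smul_def, Derivation.map_smul, theta_X]
  induction f using RatFunc.induction_on with
  | f p r hr =>
    simp only [map_div₀, Derivation.leibniz_div, hpoly, smul_eq_mul, map_mul, map_sub, map_pow,
      map_inv₀]

end Rat

section Ring

variable {K : Type u} [Field K] {O : Type u} [CommRing O] [Algebra O K]

/-- The algebra `O[x, 1/P(x), 1/P(qx), 1/P(q²x), …]` inside `K(x)`. -/
def ringA (q : O) (P : O[X]) : Subalgebra O (RatFunc K) :=
  Algebra.adjoin O (insert RatFunc.X
    (Set.range fun i : ℕ =>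
      (Polynomial.aeval (algebraMap O (RatFunc K) (q ^ i) * RatFunc.X) P)⁻¹))

variable {q : O} (hq0 : algebraMap O K q ≠ 0)

/-- `δ_q f = (f(qx) - f(x)) / (q - 1)`. -/
def deltaK : RatFunc K →ₗ[O] RatFunc K :=
  ((algebraMap O K q - 1)⁻¹ •
    ((sigma hq0).toLinearMap - (LinearMap.id : RatFunc K →ₗ[K] RatFunc K))).restrictScalars O

theorem deltaK_apply (f : RatFunc K) :
    deltaK hq0 f = (algebraMap O K q - 1)⁻¹ • (sigma hq0 f - f) := rfl

theorem sigma_eq (hq1 : algebraMap O K q ≠ 1) (f : RatFunc K) : sigma hq0 f = f + (q - 1) • deltaK hq0 f := by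
  have h : algebraMap O K q - 1 ≠ 0 := sub_ne_zero.2 hq1
  rw [deltaK_apply, ← algebraMap_smul K (q - 1), map_sub, map_one, smul_smul, mul_inv_cancel₀ h,
    one_smul]
  ring

theorem deltaK_mul' (f g : RatFunc K) :
    deltaK hq0 (f * g) = sigma hq0 f * deltaK hq0 g + deltaK hq0 f * g := by
  simp only [deltaK_apply, map_mul, Algebra.smul_def]; ring

theorem deltaK_mul (hq1 : algebraMap O K q ≠ 1) (f g : RatFunc K) :
    deltaK hq0 (f * g) = f * deltaK hq0 g + deltaK hq0 f * g
      + (q - 1) • (deltaK hq0 f * deltaK hq0 g) := by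
  rw [deltaK_mul', sigma_eq hq0 hq1, add_mul, smul_mul_assoc]; ring

theorem deltaK_algebraMap (c : O) : deltaK hq0 (algebraMap O (RatFunc K) c) = 0 := by
  rw [deltaK_apply, IsScalarTower.algebraMap_apply O K (RatFunc K), AlgHom.commutes, sub_self,
    smul_zero]

theorem sigma_point (i : ℕ) : sigma hq0 (algebraMap O (RatFunc K) (q ^ i) * RatFunc.X)
    = algebraMap O (RatFunc K) (q ^ (i + 1)) * RatFunc.X := by
  rw [map_mul, sigma_X, IsScalarTower.algebraMap_apply O K (RatFunc K), AlgHom.commutes,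
    IsScalarTower.algebraMap_apply O K (RatFunc K) (q ^ (i + 1)), pow_succ, map_mul, map_mul]
  ring

variable (P : O[X])

theorem X_mem : (RatFunc.X : RatFunc K) ∈ ringA q P :=
  Algebra.subset_adjoin (Set.mem_insert _ _)

theorem inv_mem (i : ℕ) :
    (Polynomial.aeval (algebraMap O (RatFunc K) (q ^ i) * RatFunc.X) P)⁻¹ ∈ ringA (K := K) q P :=
  Algebra.subset_adjoin (Set.mem_insert_of_mem _ ⟨i, rfl⟩)

theorem point_mem (i : ℕ) :
    algebraMap O (RatFunc K) (q ^ i) * RatFunc.X ∈ ringA (K := K) q P :=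
  mul_mem (Subalgebra.algebraMap_mem _ _) (X_mem P)

theorem aeval_mem (i : ℕ) (p : O[X]) :
    Polynomial.aeval (algebraMap O (RatFunc K) (q ^ i) * RatFunc.X) p ∈ ringA (K := K) q P :=
  Algebra.adjoin_le (Set.singleton_subset_iff.2 (point_mem P i))
    (Polynomial.aeval_mem_adjoin_singleton O _)

theorem deltaK_X (hq1 : algebraMap O K q ≠ 1) : deltaK hq0 (RatFunc.X : RatFunc K) = RatFunc.X := by
  have h : algebraMap O K q - 1 ≠ 0 := sub_ne_zero.2 hq1
  rw [deltaK_apply, sigma_X, ← Algebra.smul_def, show (algebraMap O K q) • (RatFunc.X : RatFunc K)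
    - RatFunc.X = (algebraMap O K q - 1) • RatFunc.X by rw [sub_smul, one_smul], smul_smul,
    inv_mul_cancel₀ h, one_smul]

theorem deltaK_aeval_mem (hq1 : algebraMap O K q ≠ 1) (P : O[X]) (i : ℕ) (p : O[X]) :
    deltaK hq0 (Polynomial.aeval (algebraMap O (RatFunc K) (q ^ i) * RatFunc.X) p)
      ∈ ringA (K := K) q P := by
  induction p using Polynomial.induction_on' with
  | add a b ha hb => rw [map_add, map_add]; exact add_mem ha hb
  | monomial n c =>
    rw [Polynomial.aeval_monomial, ← Algebra.smul_def, map_smul]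
    refine Subalgebra.smul_mem _ ?_ _
    induction n with
    | zero =>
      rw [pow_zero, ← map_one (algebraMap O (RatFunc K)), deltaK_algebraMap]
      exact zero_mem _
    | succ n ih =>
      rw [pow_succ, deltaK_mul hq0 hq1, ← Algebra.smul_def, map_smul, deltaK_X hq0 hq1,
        Algebra.smul_def]
      have hx := point_mem (K := K) (q := q) P i
      exact add_mem (add_mem (mul_mem (pow_mem hx n) hx) (mul_mem ih hx))
        (Subalgebra.smul_mem _ (mul_mem ih hx) _)

theorem deltaK_mem (hq1 : algebraMap O K q ≠ 1) (P : O[X]) {f : RatFunc K} (hf : f ∈ ringA q P) : deltaK hq0 f ∈ ringA q P := by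
  induction hf using Algebra.adjoin_induction with
  | mem f hf =>
    rcases hf with rfl | ⟨i, rfl⟩
    · rw [deltaK_X hq0 hq1]; exact X_mem P
    · set y := Polynomial.aeval (algebraMap O (RatFunc K) (q ^ i) * RatFunc.X) P with hy
      have hs : sigma hq0 y =
          Polynomial.aeval (algebraMap O (RatFunc K) (q ^ (i + 1)) * RatFunc.X) P := by
        rw [hy, ← sigma_point hq0 i]
        exact (Polynomial.aeval_algHom_apply ((sigma hq0).restrictScalars O) _ P).symm
      have hd : deltaK hq0 y ∈ ringA q P := deltaK_aeval_mem hq0 hq1 P i P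
      change deltaK hq0 y⁻¹ ∈ _
      rcases eq_or_ne y 0 with h0 | h0
      · rw [h0, inv_zero, map_zero]; exact zero_mem _
      · have h1 : sigma hq0 y ≠ 0 := by simpa using h0
        have : deltaK hq0 y⁻¹ = -((sigma hq0 y)⁻¹ * y⁻¹ * deltaK hq0 y) := by
          simp only [deltaK_apply, map_inv₀, Algebra.smul_def]
          field_simp
          ring
        rw [this]
        exact neg_mem (mul_mem (mul_mem (hs ▸ inv_mem P (i + 1)) (inv_mem P i)) hd)
  | algebraMap r => rw [deltaK_algebraMap]; exact zero_mem _
  | add a b _ _ ha hb => rw [map_add]; exact add_mem ha hb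
  | mul a b ha' hb' ha hb =>
    rw [deltaK_mul hq0 hq1]
    exact add_mem (add_mem (mul_mem ha' hb) (mul_mem ha hb'))
      (Subalgebra.smul_mem _ (mul_mem ha hb) _)

theorem theta_algebraMap (c : O) : theta K (algebraMap O (RatFunc K) c) = 0 := by
  rw [IsScalarTower.algebraMap_apply O K (RatFunc K)]; exact (theta K).map_algebraMap _

theorem theta_aeval_mem (i : ℕ) :
    theta K (Polynomial.aeval (algebraMap O (RatFunc K) (q ^ i) * RatFunc.X) P)
      ∈ ringA (K := K) q P := by
  have h : theta K (algebraMap O (RatFunc K) (q ^ i) * RatFunc.X)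
      = algebraMap O (RatFunc K) (q ^ i) * RatFunc.X := by
    rw [Derivation.leibniz, theta_algebraMap, theta_X, smul_zero, add_zero, smul_eq_mul]
  have h2 := Derivation.map_aeval ((theta K).restrictScalars O) P
    (algebraMap O (RatFunc K) (q ^ i) * RatFunc.X)
  change theta K _ = _ • theta K _ at h2
  rw [h2, h]
  exact mul_mem (aeval_mem P i _) (point_mem P i)

theorem theta_mem {f : RatFunc K} (hf : f ∈ ringA q P) : theta K f ∈ ringA q P := by
  induction hf using Algebra.adjoin_induction with
  | mem f hf =>
    rcases hf with rfl | ⟨i, rfl⟩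
    · rw [theta_X]; exact X_mem P
    · change theta K (_)⁻¹ ∈ _
      rw [Derivation.leibniz_inv]
      exact mul_mem (neg_mem (pow_mem (inv_mem P i) 2)) (theta_aeval_mem P i)
  | algebraMap r => rw [theta_algebraMap]; exact zero_mem _
  | add a b _ _ ha hb => rw [map_add]; exact add_mem ha hb
  | mul a b ha' hb' ha hb =>
    rw [Derivation.leibniz]
    exact add_mem (mul_mem ha' hb) (mul_mem hb' ha)

/-- The generalized differential ring `(𝒜, δ_q)`, `𝒜 = O[x, 1/P(x), 1/P(qx), …]`, with
`h = q - 1`, `δ_q f = (f(qx) - f(x)) / (q - 1)` and `∂ = x d/dx`. -/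
def qdRing (hq1 : algebraMap O K q ≠ 1) (P : O[X]) : QDRing O (ringA (K := K) q P) where
  h := q - 1
  δ := (deltaK hq0).restrict (p := Subalgebra.toSubmodule (ringA q P))
    (q := Subalgebra.toSubmodule (ringA q P)) (fun _ hf => deltaK_mem hq0 hq1 P hf)
  δ_one := Subtype.ext (by
    change deltaK hq0 (1 : RatFunc K) = 0
    rw [← map_one (algebraMap O (RatFunc K)), deltaK_algebraMap])
  δ_mul a b := Subtype.ext (deltaK_mul hq0 hq1 (a : RatFunc K) b)
  der := Derivation.mk'
    ((((theta K).restrictScalars O : Derivation O (RatFunc K) (RatFunc K)) :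
        RatFunc K →ₗ[O] RatFunc K).restrict (p := Subalgebra.toSubmodule (ringA q P))
      (q := Subalgebra.toSubmodule (ringA q P)) (fun _ hf => theta_mem P hf))
    (fun a b => Subtype.ext ((theta K).leibniz (a : RatFunc K) b))
  δ_der a := Subtype.ext (by
    change deltaK hq0 (theta K (a : RatFunc K)) = theta K (deltaK hq0 (a : RatFunc K))
    rw [deltaK_apply, deltaK_apply, Derivation.map_smul, map_sub, theta_sigma])

end Ring
end QRat

/-! ## The parameter `q` and its specializations -/

namespace QSpec

open FunctionField

variable (k K : Type u) [Field k] [Field K] [Algebra k[X] K]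

/-- The parameter `q`, i.e. the variable of `k(q)`, as an element of the integral closure
`O_K` of `k[q]` in `K`. -/
def q : ringOfIntegers k K := algebraMap k[X] (ringOfIntegers k K) Polynomial.X

theorem algebraMap_q (k K : Type u) [Field k] [Field K] [Algebra k[X] K] :
    algebraMap (ringOfIntegers k K) K (q k K) =
      algebraMap k[X] K Polynomial.X :=
  (IsScalarTower.algebraMap_apply k[X] (ringOfIntegers k K) K _).symm

variable [Algebra (RatFunc k) K] [IsScalarTower k[X] (RatFunc k) K]

theorem q_ne_zero : algebraMap (ringOfIntegers k K) K (q k K) ≠ 0 := by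
  rw [algebraMap_q, Ne, map_eq_zero_iff _ (FunctionField.algebraMap_injective k K)]
  exact Polynomial.X_ne_zero

theorem q_ne_one : algebraMap (ringOfIntegers k K) K (q k K) ≠ 1 := by
  rw [algebraMap_q, ← map_one (algebraMap k[X] K), Ne,
    (FunctionField.algebraMap_injective k K).eq_iff]
  exact fun h => by simpa using congrArg Polynomial.natDegree h

variable {k K}

/-- The ring `𝒜 = O_K[x, 1/P(x), 1/P(qx), …] ⊆ K(x)`. -/
abbrev A (P : (ringOfIntegers k K)[X]) :=
  QRat.ringA (K := K) (q k K) P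

/-- The generalized differential ring `(𝒜, δ_q)` over `O_K`, with the derivation `x d/dx`. -/
abbrev ringA (P : (ringOfIntegers k K)[X]) : QDRing (ringOfIntegers k K) (A P) :=
  QRat.qdRing (q_ne_zero k K) (q_ne_one k K) P

/-- The residue field `k_v = O_K / v`. -/
abbrev resField (v : IsDedekindDomain.HeightOneSpectrum (ringOfIntegers k K)) : Type u :=
  ringOfIntegers k K ⧸ v.asIdeal

/-- `𝒜_v = 𝒜 ⊗_{O_K} k_v`. -/
abbrev Av (P : (ringOfIntegers k K)[X])
    (v : IsDedekindDomain.HeightOneSpectrum (ringOfIntegers k K)) : Type u :=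
  QDRing.Red (ringOfIntegers k K) (resField v) (A P)

/-- The projection `𝒜 → 𝒜_v` is a morphism of generalized differential rings. -/
theorem compat (P : (ringOfIntegers k K)[X])
    (v : IsDedekindDomain.HeightOneSpectrum (ringOfIntegers k K)) :
    QDRing.Compat (ringA P) ((ringA P).red (resField v)) :=
  (ringA P).red_compat (resField v)

/-- The specialization `ℳ ⊗_𝒜 𝒜_v`, an object of `Diff_{𝒜_v}`. -/
abbrev spec {P : (ringOfIntegers k K)[X]} (M : DMod (ringA P))
    (v : IsDedekindDomain.HeightOneSpectrum (ringOfIntegers k K)) :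
    DMod ((ringA P).red (resField v)) :=
  M.baseChange (compat P v)

end QSpec

end

/-!
Base change `N ↦ B' ⊗ N` along a morphism `B → B'` of generalized differential rings which is a
pushout of a morphism `R → R'` of rings of constants is compatible with every construction that
generates `⟨M⟩^⊗` and `⟨M⟩^{⊗,∂}`. The delicate case is that of subobjects: base change preserves
the injectivity of `W → N` because `N / W` is flat over `R`, and `B' ⊗ (N / W)` is again flat over
`R'`. For prolongations a surjection `F_∂(B' ⊗ N) → B' ⊗ F_∂(N)` is enough, since quotients are
allowed. A tensor automorphism of the fibre functor on the category generated by `B' ⊗ M` therefore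
restricts along base change to one on the category generated by `M`, with the same value on
`S ⊗ M = S ⊗ (B' ⊗ M)`.
-/

noncomputable section

section FlatOver

variable (R B : Type*) [CommRing R] [CommRing B] [Algebra R B]

/-- A `B`-module is flat over `R` if it is flat as an `R`-module by restriction of scalars; this is
the condition on the cokernels of the admissible subobjects. -/
def FlatOver (Q : Type*) [AddCommGroup Q] [Module B Q] : Prop :=
  letI : Module R Q := Module.compHom Q (algebraMap R B)
  Module.Flat R Q

variable {R B} {Q Q' : Type*} [AddCommGroup Q] [Module B Q] [AddCommGroup Q'] [Module B Q']

theorem flatOver_iff_flat [Module R Q] [IsScalarTower R B Q] :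
    FlatOver R B Q ↔ Module.Flat R Q := by
  have compHom_eq : Module.compHom Q (algebraMap R B) = ‹Module R Q› :=
    Module.ext' _ _ fun r x => algebraMap_smul B r x
  rw [FlatOver, compHom_eq]

theorem FlatOver.of_linearEquiv (hQ : FlatOver R B Q) (e : Q' ≃ₗ[B] Q) : FlatOver R B Q' := by
  let : Module R Q := .compHom _ (algebraMap R B)
  let : Module R Q' := .compHom _ (algebraMap R B)
  have : IsScalarTower R B Q := .of_algebraMap_smul fun _ _ => rfl
  have : IsScalarTower R B Q' := .of_algebraMap_smul fun _ _ => rfl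
  have : Module.Flat R Q := hQ
  exact Module.Flat.of_linearEquiv (e.restrictScalars R)

end FlatOver

section Pushout

variable {R : Type*} (R' : Type*) {B : Type*} (B' : Type*) [CommRing R] [CommRing R'] [CommRing B]
  [CommRing B'] [Algebra R R'] [Algebra R B] [Algebra R B'] [Algebra R' B'] [Algebra B B']
  [IsScalarTower R R' B'] [IsScalarTower R B B'] [Algebra.IsPushout R R' B B']
  {N N' Q : Type*} [AddCommGroup N] [Module B N] [AddCommGroup N'] [Module B N']
  [AddCommGroup Q] [Module B Q]

open Algebra.IsPushout (cancelBaseChange)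

theorem baseChange_comp_cancelBaseChange_symm [Module R N] [IsScalarTower R B N] [Module R N']
    [IsScalarTower R B N'] (f : N →ₗ[B] N') :
    f.baseChange B' ∘ (cancelBaseChange R R' B B' N).symm =
      (cancelBaseChange R R' B B' N').symm ∘ (f.restrictScalars R).baseChange R' := by
  funext z
  induction z with
  | zero => simp only [Function.comp_apply, map_zero]
  | add x y hx hy => simp only [Function.comp_apply, map_add] at hx hy ⊢; rw [hx, hy]
  | tmul r n =>
    simp only [Function.comp_apply, LinearMap.baseChange_tmul,
      Algebra.IsPushout.cancelBaseChange_symm_tmul, LinearMap.restrictScalars_apply]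

theorem FlatOver.baseChange (hQ : FlatOver R B Q) : FlatOver R' B' (B' ⊗[B] Q) := by
  let : Module R Q := .compHom _ (algebraMap R B)
  have : IsScalarTower R B Q := .of_algebraMap_smul fun _ _ => rfl
  have : Module.Flat R Q := hQ
  exact flatOver_iff_flat.2 (.of_linearEquiv (cancelBaseChange R R' B B' Q))

include R' in
theorem FlatOver.baseChange_injective (hQ : FlatOver R B Q) {f : N →ₗ[B] N'} {g : N' →ₗ[B] Q}
    (hf : Function.Injective f) (hfg : Function.Exact f g) (hg : Function.Surjective g) :
    Function.Injective (f.baseChange B') := by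
  let : Module R N := .compHom _ (algebraMap R B)
  let : Module R N' := .compHom _ (algebraMap R B)
  let : Module R Q := .compHom _ (algebraMap R B)
  have : IsScalarTower R B N := .of_algebraMap_smul fun _ _ => rfl
  have : IsScalarTower R B N' := .of_algebraMap_smul fun _ _ => rfl
  have : IsScalarTower R B Q := .of_algebraMap_smul fun _ _ => rfl
  have : Module.Flat R Q := hQ
  have baseChange_injective_over_R : Function.Injective ((f.restrictScalars R).baseChange R') :=
    LinearMap.lTensor_injective_of_exact_of_flat (g.restrictScalars R) hg (f.restrictScalars R) hf
      hfg R'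
  rw [← Function.Injective.of_comp_iff' _ (cancelBaseChange R R' B B' N).symm.bijective,
    baseChange_comp_cancelBaseChange_symm]
  exact (cancelBaseChange R R' B B' N').symm.injective.comp baseChange_injective_over_R

end Pushout

section Dual

variable {B : Type*} (B' : Type*) (N : Type*) [CommRing B] [CommRing B'] [Algebra B B']
  [AddCommGroup N] [Module B N]

/-- The canonical map `B' ⊗ Hom(N, B) → Hom(B' ⊗ N, B')`. -/
def dualBaseChange : B' ⊗[B] Module.Dual B N →ₗ[B'] Module.Dual B' (B' ⊗[B] N) :=
  (Module.Dual.baseChange B' (R := B) (V := N)).liftBaseChange B'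

theorem dualBaseChange_tmul (b b' : B') (φ : Module.Dual B N) (n : N) :
    dualBaseChange B' N (b ⊗ₜ φ) (b' ⊗ₜ n) = b * b' * algebraMap B B' (φ n) := by
  simp only [dualBaseChange, LinearMap.liftBaseChange_tmul, LinearMap.smul_apply,
    Module.Dual.baseChange_apply_tmul, smul_eq_mul]
  rw [Algebra.smul_def]
  ring

theorem dualBaseChange_bijective [Module.Finite B N] [Module.Projective B N] :
    Function.Bijective (dualBaseChange (B := B) B' N) := by
  have factor : dualBaseChange (B := B) B' N =
      LinearMap.liftBaseChangeEquiv B' ∘ dualTensorHom B N B' ∘ TensorProduct.comm B B' _ := by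
    funext z
    induction z with
    | zero => simp only [map_zero, Function.comp_apply]
    | add x y hx hy => simp only [map_add, Function.comp_apply] at hx hy ⊢; rw [hx, hy]
    | tmul b φ =>
      ext n
      simp [dualBaseChange_tmul, Algebra.smul_def, mul_comm]
  rw [factor]
  exact (LinearMap.liftBaseChangeEquiv B').bijective.comp
    (dualTensorHom_bijective.comp (TensorProduct.comm B B' _).bijective)

end Dual

namespace QDRing

variable {R B R' B' : Type*} [CommRing R] [CommRing B] [Algebra R B] [CommRing R'] [CommRing B']
  [Algebra R' B'] [Algebra B B'] {D : QDRing R B} {D' : QDRing R' B'}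

theorem σ_one (D : QDRing R B) : D.σ 1 = 1 := by
  rw [σ, D.δ_one, smul_zero, add_zero]

theorem σ_der (D : QDRing R B) (b : B) : D.σ (D.der b) = D.der (D.σ b) := by
  rw [σ, σ, map_add, Derivation.map_smul, D.δ_der]

/-- The target `(B', ∂)` of a morphism of generalized differential rings, as a `∂`-algebra over its
source `(B, ∂)`. -/
def Compat.dAlg (c : Compat D D') : D.DAlg B' where
  der := D'.der.restrictScalars ℤ
  der_algebraMap := c.map_der

end QDRing

namespace DMod

open TensorProduct.AlgebraTensorModule (rid cancelBaseChange distribBaseChange)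

variable {R : Type*} {B : Type u} [CommRing R] [CommRing B] [Algebra R B] {D : QDRing R B}

theorem Sig_add (N : DMod D) (x y : N) : N.Sig (x + y) = N.Sig x + N.Sig y := by
  simp only [Sig, map_add, smul_add, add_add_add_comm]

/-- The inverse of a bijective horizontal morphism. -/
def Hom.symm {N N' : DMod D} (f : Hom N N') (hf : Function.Bijective f.toLin) : Hom N' N where
  toLin := (LinearEquiv.ofBijective f.toLin hf).symm.toLinearMap
  horiz n := by
    obtain ⟨n, rfl⟩ := hf.surjective n
    rw [← f.horiz]
    simp only [LinearEquiv.coe_coe, LinearEquiv.ofBijective_symm_apply_apply]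

theorem Gen.of_bijective {p : Prop} {M N N' : DMod D} (hN' : Gen p M N') (f : Hom N N')
    (hf : Function.Bijective f.toLin) : Gen p M N :=
  .quot (f.symm hf) hN' (LinearEquiv.ofBijective f.toLin hf).symm.surjective

/-- The inclusion of `N` into its prolongation `F_∂(N)`, as a horizontal morphism. -/
def Hom.incl (N : DMod D) : Hom N N.prolong where
  toLin := Prol.incl D N
  horiz _ := Prod.ext rfl (map_zero N.Δ).symm

theorem Prol.incl_add_del {N : Type u} [AddCommGroup N] [Module B N] (z : Prol D N) :
    Prol.incl D N z.1 + Prol.del D N z.2 = z :=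
  Prod.ext (add_zero z.1) (zero_add z.2)

theorem prolong_Δ_del (N : DMod D) (n : N) :
    N.prolong.Δ (Prol.del D N n) = Prol.del D N (N.Δ n) :=
  Prod.ext (map_zero N.Δ) rfl

section delS

variable {S : Type*} [CommRing S] [Algebra B S]

theorem delS_tmul (E : D.DAlg S) (N : DMod D) (s : S) (n : N) :
    delS E N (s ⊗ₜ n) = E.der s ⊗ₜ[B] Prol.incl D N n + s ⊗ₜ[B] Prol.del D N n := rfl

theorem delS_one_tmul (E : D.DAlg S) (N : DMod D) (n : N) :
    delS E N (1 ⊗ₜ n) = 1 ⊗ₜ[B] Prol.del D N n := by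
  rw [delS_tmul, Derivation.map_one_eq_zero, TensorProduct.zero_tmul, zero_add]

theorem delS_smul (E : D.DAlg S) (N : DMod D) (s : S) (z : S ⊗[B] N) :
    delS E N (s • z) = s • delS E N z + E.der s • (Prol.incl D N).baseChange S z := by
  induction z with
  | zero => simp only [smul_zero, map_zero, add_zero]
  | add x y hx hy => simp only [smul_add, map_add, hx, hy, add_add_add_comm]
  | tmul t n =>
    simp only [TensorProduct.smul_tmul', smul_eq_mul, delS_tmul, Derivation.leibniz,
      LinearMap.baseChange_tmul, TensorProduct.add_tmul, smul_add, mul_comm (E.der s)]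
    abel

end delS

section BaseChange

variable {R' : Type*} {B' : Type u} [CommRing R'] [CommRing B'] [Algebra R' B'] [Algebra B B']
  {D' : QDRing R' B'}

theorem baseChangeΔ_one_tmul (c : QDRing.Compat D D') (N : DMod D) (n : N) :
    baseChangeΔ c N (1 ⊗ₜ n) = 1 ⊗ₜ N.Δ n := by
  rw [baseChangeΔ_tmul, D'.δ_one, D'.σ_one, TensorProduct.zero_tmul, zero_add]

theorem Sig_baseChange_tmul (c : QDRing.Compat D D') (N : DMod D) (b : B') (n : N) :
    (N.baseChange c).Sig (b ⊗ₜ[B] n) = D'.σ b ⊗ₜ[B] N.Sig n := by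
  have map_h_smul : algebraMap R' B' D'.h • D'.σ b ⊗ₜ[B] N.Δ n
      = D'.σ b ⊗ₜ[B] (algebraMap R B D.h • N.Δ n) := by
    rw [c.map_h, algebraMap_smul, TensorProduct.tmul_smul]
  simp only [Sig, baseChangeΔ_tmul, smul_add, map_h_smul, TensorProduct.tmul_add]
  rw [← add_assoc, TensorProduct.smul_tmul', ← TensorProduct.add_tmul, smul_eq_mul, ← σ_eq]

/-- The horizontal morphism out of `B' ⊗ N` given by a `B'`-linear map that is horizontal on
`1 ⊗ N`. -/
def Hom.ofBaseChange (c : QDRing.Compat D D') {N : DMod D} {N' : DMod D'}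
    (f : B' ⊗[B] N →ₗ[B'] N') (hf : ∀ n, f (1 ⊗ₜ N.Δ n) = N'.Δ (f (1 ⊗ₜ n))) :
    Hom (N.baseChange c) N' where
  toLin := f
  horiz z := by
    have map_tmul (b : B') (n : N) : f (b ⊗ₜ n) = b • f (1 ⊗ₜ n) := by
      rw [← map_smul, TensorProduct.smul_tmul', smul_eq_mul, mul_one]
    induction z using TensorProduct.induction_on with
    | zero => simp only [map_zero]
    | add x y hx hy => simp only [map_add, hx, hy]
    | tmul b n =>
      rw [baseChangeΔ_tmul, map_add, map_tmul b, map_tmul (D'.δ b), map_tmul (D'.σ b), N'.leibniz,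
        hf, add_comm]

/-- The base change of a horizontal morphism. -/
def Hom.baseChange (c : QDRing.Compat D D') {N N' : DMod D} (f : Hom N N') :
    Hom (N.baseChange c) (N'.baseChange c) :=
  .ofBaseChange c (f.toLin.baseChange B') fun n => by
    rw [LinearMap.baseChange_tmul, LinearMap.baseChange_tmul, baseChangeΔ_one_tmul, f.horiz]

/-- The comparison isomorphism `B' → B' ⊗ B` of unit objects. -/
def unitBaseChange (c : QDRing.Compat D D') : Hom (unit D') ((unit D).baseChange c) where
  toLin := (rid B B' B').symm.toLinearMap
  horiz b := by
    change D'.δ b ⊗ₜ[B] (1 : B) = D'.δ b ⊗ₜ 1 + D'.σ b ⊗ₜ D.δ 1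
    rw [D.δ_one, TensorProduct.tmul_zero, add_zero]

/-- The comparison isomorphism `B' ⊗ (N × N') → (B' ⊗ N) × (B' ⊗ N')`. -/
def baseChangeProd (c : QDRing.Compat D D') (N N' : DMod D) :
    Hom ((N.prod N').baseChange c) ((N.baseChange c).prod (N'.baseChange c)) :=
  .ofBaseChange c (TensorProduct.prodRight B B' B' N N').toLinearMap fun n =>
    Prod.ext (baseChangeΔ_one_tmul c N n.1).symm (baseChangeΔ_one_tmul c N' n.2).symm

/-- The comparison isomorphism `B' ⊗ (N ⊗ N') → (B' ⊗ N) ⊗ (B' ⊗ N')`. -/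
def baseChangeTensor (c : QDRing.Compat D D') (N N' : DMod D) :
    Hom ((N.tensor N').baseChange c) ((N.baseChange c).tensor (N'.baseChange c)) :=
  .ofBaseChange c (distribBaseChange B B' N N').toLinearMap fun z => by
    induction z using TensorProduct.induction_on with
    | zero => simp only [map_zero, TensorProduct.tmul_zero]
    | add x y hx hy => simp only [map_add, TensorProduct.tmul_add] at hx hy ⊢; rw [hx, hy]
    | tmul n n' =>
      refine Eq.trans ?_ (tensorΔ_tmul (N.baseChange c) (N'.baseChange c) (1 ⊗ₜ n) (1 ⊗ₜ n')).symm
      rw [Sig_baseChange_tmul, D'.σ_one]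
      simp only [baseChangeΔ_one_tmul, tensorΔ_tmul, TensorProduct.tmul_add, map_add,
        LinearEquiv.coe_coe, TensorProduct.AlgebraTensorModule.distribBaseChange_tmul]

theorem IsDual.baseChange (c : QDRing.Compat D D') {N N' : DMod D} (h : IsDual N N') :
    IsDual (N.baseChange c) (N'.baseChange c) := by
  obtain ⟨e, he⟩ := h
  refine ⟨(e.baseChange B B' N' (Module.Dual B N)) ≪≫ₗ
    LinearEquiv.ofBijective (dualBaseChange B' N) (dualBaseChange_bijective B' N),
    fun φ n => ?_⟩
  induction φ using TensorProduct.induction_on with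
  | zero => simp only [map_zero, LinearMap.zero_apply, add_zero]
  | add x y hx hy => simp only [map_add, LinearMap.add_apply, hx, hy, add_add_add_comm]
  | tmul b φ =>
    induction n using TensorProduct.induction_on with
    | zero => simp [Sig]
    | add x y hx hy =>
      have Sig_add_eq := Sig_add (N.baseChange c) x y
      simp only [Sig_add_eq, map_add, hx, hy, add_add_add_comm]
    | tmul b' n =>
      have map_δ_pairing := congrArg (algebraMap B B') (he φ n)
      have map_pairing_Sig : algebraMap B B' (e φ (N.Sig n)) = algebraMap B B' (e φ n)
          + algebraMap R' B' D'.h * algebraMap B B' (e φ (N.Δ n)) := by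
        simp only [Sig, map_add, map_smul, smul_eq_mul, map_mul, c.map_h]
      simp only [Sig_baseChange_tmul, baseChangeΔ_tmul, LinearEquiv.trans_apply,
        LinearEquiv.baseChange_tmul, LinearEquiv.ofBijective_apply, map_add, LinearMap.add_apply,
        dualBaseChange_tmul, map_pairing_Sig]
      rw [δ_mul', δ_mul', c.map_δ, map_δ_pairing, map_add, σ_mul]
      simp only [σ_eq]
      ring

theorem baseChangeΔ_delS (c : QDRing.Compat D D') (N : DMod D) (y : B' ⊗[B] N) :
    baseChangeΔ c N.prolong (delS c.dAlg N y) = delS c.dAlg N (baseChangeΔ c N y) := by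
  induction y with
  | zero => simp only [map_zero]
  | add x y hx hy => simp only [map_add, hx, hy]
  | tmul b n =>
    have Δ_tmul_incl (b : B') : baseChangeΔ c N.prolong (b ⊗ₜ[B] Prol.incl D N n) =
        D'.δ b ⊗ₜ[B] Prol.incl D N n + D'.σ b ⊗ₜ[B] Prol.incl D N (N.Δ n) :=
      congrArg (D'.δ b ⊗ₜ[B] Prol.incl D N n + D'.σ b ⊗ₜ[B] ·) ((Hom.incl N).horiz n).symm
    have Δ_tmul_del : baseChangeΔ c N.prolong (b ⊗ₜ[B] Prol.del D N n) =
        D'.δ b ⊗ₜ[B] Prol.del D N n + D'.σ b ⊗ₜ[B] Prol.del D N (N.Δ n) :=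
      congrArg (D'.δ b ⊗ₜ[B] Prol.del D N n + D'.σ b ⊗ₜ[B] ·) (prolong_Δ_del N n)
    have der_eq (b : B') : c.dAlg.der b = D'.der b := rfl
    simp only [baseChangeΔ_tmul, delS_tmul, map_add, Δ_tmul_incl, Δ_tmul_del, der_eq, D'.δ_der,
      D'.σ_der]
    abel

/-- The comparison morphism `F_∂(B' ⊗ N) → B' ⊗ F_∂(N)`, which is the identity on `B' ⊗ N`
and intertwines the two maps `∂`. -/
def prolongBaseChange (c : QDRing.Compat D D') (N : DMod D) :
    Hom (N.baseChange c).prolong (N.prolong.baseChange c) where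
  toLin :=
    { toFun := fun z => (Prol.incl D N).baseChange B' z.1 + delS c.dAlg N z.2
      map_add' := fun x y => by
        change (Prol.incl D N).baseChange B' (x.1 + y.1) + delS c.dAlg N (x.2 + y.2) = _
        rw [map_add, map_add, add_add_add_comm]
      map_smul' := fun b z => by
        change (Prol.incl D N).baseChange B' (b • z.1 - D'.der b • z.2) + delS c.dAlg N (b • z.2) =
          b • ((Prol.incl D N).baseChange B' z.1 + delS c.dAlg N z.2)
        have der_eq : c.dAlg.der b = D'.der b := rfl
        rw [delS_smul, der_eq, map_sub, map_smul, map_smul, smul_add]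
        abel }
  horiz z := by
    change (Prol.incl D N).baseChange B' (baseChangeΔ c N z.1) +
        delS c.dAlg N (baseChangeΔ c N z.2) =
      baseChangeΔ c N.prolong ((Prol.incl D N).baseChange B' z.1 + delS c.dAlg N z.2)
    rw [map_add, baseChangeΔ_delS]
    exact congrArg (· + _) (((Hom.incl N).baseChange c).horiz z.1)

theorem prolongBaseChange_incl (c : QDRing.Compat D D') (N : DMod D) (y : B' ⊗[B] N) :
    (prolongBaseChange c N).toLin (Prol.incl D' (B' ⊗[B] N) y) =
      (Prol.incl D N).baseChange B' y :=
  (congrArg (_ + ·) (map_zero _)).trans (add_zero _)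

theorem prolongBaseChange_del (c : QDRing.Compat D D') (N : DMod D) (y : B' ⊗[B] N) :
    (prolongBaseChange c N).toLin (Prol.del D' (B' ⊗[B] N) y) = delS c.dAlg N y :=
  (congrArg (· + _) (map_zero _)).trans (zero_add _)

theorem prolongBaseChange_surjective (c : QDRing.Compat D D') (N : DMod D) :
    Function.Surjective (prolongBaseChange c N).toLin := by
  rw [← LinearMap.range_eq_top, eq_top_iff]
  rintro z -
  induction z using TensorProduct.induction_on with
  | zero => exact zero_mem _
  | add x y hx hy => exact add_mem hx hy
  | tmul b z =>
    have tmul_eq : b ⊗ₜ[B] z =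
        b • (prolongBaseChange c N).toLin
          (Prol.incl D' (B' ⊗[B] N) (1 ⊗ₜ z.1) + Prol.del D' (B' ⊗[B] N) (1 ⊗ₜ z.2)) := by
      rw [map_add, prolongBaseChange_incl, prolongBaseChange_del, LinearMap.baseChange_tmul,
        delS_one_tmul, ← TensorProduct.tmul_add, Prol.incl_add_del, TensorProduct.smul_tmul',
        smul_eq_mul, mul_one]
    rw [tmul_eq]
    exact Submodule.smul_mem _ b (LinearMap.mem_range_self _ _)

section Pushout

variable [Algebra R R'] [Algebra R B'] [IsScalarTower R R' B'] [IsScalarTower R B B']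
  [Algebra.IsPushout R R' B B']

theorem Hom.FlatCoker.baseChange_injective (c : QDRing.Compat D D') {W N : DMod D} {f : Hom W N}
    (hf : f.FlatCoker) (hf' : Function.Injective f.toLin) :
    Function.Injective (f.baseChange c).toLin :=
  FlatOver.baseChange_injective (R := R) R' B' hf hf' (LinearMap.exact_map_mkQ_range f.toLin)
    (Submodule.mkQ_surjective _)

theorem Hom.FlatCoker.baseChange (c : QDRing.Compat D D') {W N : DMod D} {f : Hom W N}
    (hf : f.FlatCoker) : (f.baseChange c).FlatCoker := by
  have coker_exact : Function.Exact (f.toLin.baseChange B')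
      ((LinearMap.range f.toLin).mkQ.baseChange B') :=
    lTensor_exact B' (LinearMap.exact_map_mkQ_range f.toLin) (Submodule.mkQ_surjective _)
  exact FlatOver.of_linearEquiv (FlatOver.baseChange (R := R) R' B' hf)
    (coker_exact.linearEquivOfSurjective
      (LinearMap.lTensor_surjective B' (Submodule.mkQ_surjective _)))

theorem Gen.baseChange (c : QDRing.Compat D D') {p : Prop} {M N : DMod D} (hN : Gen p M N) :
    Gen p (M.baseChange c) (N.baseChange c) := by
  induction hN with
  | base => exact .base
  | unit => exact .quot (unitBaseChange c) .unit (rid B B' B').symm.surjective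
  | prod _ _ h h' =>
    exact (h.prod h').of_bijective (baseChangeProd c _ _)
      (TensorProduct.prodRight B B' B' _ _).bijective
  | tensor _ _ h h' =>
    exact (h.tensor h').of_bijective (baseChangeTensor c _ _) (distribBaseChange B B' _ _).bijective
  | dual _ hd h => exact h.dual (hd.baseChange c)
  | sub f _ hf hf' h =>
    exact h.sub (f.baseChange c) (hf'.baseChange_injective c hf) (hf'.baseChange c)
  | quot f _ hf h => exact h.quot (f.baseChange c) (LinearMap.lTensor_surjective B' hf)
  | prolong hp _ h =>
    exact .quot (prolongBaseChange c _) (h.prolong hp) (prolongBaseChange_surjective c _)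

end Pushout

section Descent

variable {S : Type w} [CommRing S] [Algebra B S] [Algebra B' S] [IsScalarTower B B' S]

theorem descend_cancelBaseChange (c : QDRing.Compat D D') (N : DMod D)
    (g : (S ⊗[B'] (N.baseChange c)) ≃ₗ[S] (S ⊗[B'] (N.baseChange c)))
    (y : S ⊗[B'] (N.baseChange c)) :
    descend c N g (cancelBaseChange B B' S S N y) = cancelBaseChange B B' S S N (g y) := by
  simp only [descend, LinearEquiv.trans_apply, LinearEquiv.symm_apply_apply]

theorem baseChange_cancelBaseChange {N N' : Type*} [AddCommGroup N] [Module B N] [AddCommGroup N']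
    [Module B N'] (f : N →ₗ[B] N') (y : S ⊗[B'] (B' ⊗[B] N)) :
    f.baseChange S (cancelBaseChange B B' S S N y) =
      cancelBaseChange B B' S S N' ((f.baseChange B').baseChange S y) := by
  induction y with
  | zero => simp only [map_zero]
  | add x y hx hy => simp only [map_add, hx, hy]
  | tmul s z =>
    induction z with
    | zero => simp only [map_zero, TensorProduct.tmul_zero]
    | add x y hx hy => simp only [map_add, TensorProduct.tmul_add, hx, hy]
    | tmul b n => rfl

theorem distribBaseChange_cancelBaseChange {N N' : Type*} [AddCommGroup N] [Module B N]
    [AddCommGroup N'] [Module B N'] (y : S ⊗[B'] (B' ⊗[B] (N ⊗[B] N'))) :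
    distribBaseChange B S N N' (cancelBaseChange B B' S S (N ⊗[B] N') y) =
      TensorProduct.map (cancelBaseChange B B' S S N).toLinearMap
        (cancelBaseChange B B' S S N').toLinearMap
        (distribBaseChange B' S (B' ⊗[B] N) (B' ⊗[B] N')
          ((distribBaseChange B B' N N').toLinearMap.baseChange S y)) := by
  induction y with
  | zero => simp only [map_zero]
  | add x y hx hy => simp only [map_add, hx, hy]
  | tmul s z =>
    induction z with
    | zero => simp only [map_zero, TensorProduct.tmul_zero]
    | add x y hx hy => simp only [map_add, TensorProduct.tmul_add, hx, hy]
    | tmul b z =>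
      induction z with
      | zero => simp only [map_zero, TensorProduct.tmul_zero]
      | add x y hx hy => simp only [map_add, TensorProduct.tmul_add, hx, hy]
      | tmul n n' =>
        simp only [TensorProduct.AlgebraTensorModule.cancelBaseChange_tmul,
          TensorProduct.AlgebraTensorModule.distribBaseChange_tmul, LinearMap.baseChange_tmul,
          LinearEquiv.coe_coe, TensorProduct.map_tmul, one_smul]

theorem cancelBaseChange_prolongBaseChange_delS (c : QDRing.Compat D D') (E : D'.DAlg S)
    (N : DMod D) (y : S ⊗[B'] (N.baseChange c)) :
    cancelBaseChange B B' S S N.prolong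
        ((prolongBaseChange c N).toLin.baseChange S (delS E (N.baseChange c) y)) =
      delS (E.restrict c) N (cancelBaseChange B B' S S N y) := by
  induction y using TensorProduct.induction_on with
  | zero => simp only [map_zero]
  | add x y hx hy => simp only [map_add, hx, hy]
  | tmul s z =>
    rw [delS_tmul, map_add, LinearMap.baseChange_tmul, LinearMap.baseChange_tmul,
      prolongBaseChange_incl, prolongBaseChange_del]
    induction z using TensorProduct.induction_on with
    | zero => simp only [map_zero, TensorProduct.tmul_zero, add_zero]
    | add x y hx hy =>
      simp only [map_add, TensorProduct.tmul_add] at hx hy ⊢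
      rw [← hx, ← hy, add_add_add_comm]
    | tmul b n =>
      have der_smul : E.der (b • s) = b • E.der s + D'.der b • s := by
        rw [Algebra.smul_def, Derivation.leibniz, E.der_algebraMap, algebraMap_smul, smul_eq_mul,
          mul_comm, ← Algebra.smul_def]
      have restrict_der : (E.restrict c).der = E.der := rfl
      have dAlg_der : c.dAlg.der b = D'.der b := rfl
      simp only [LinearMap.baseChange_tmul, delS_tmul, TensorProduct.tmul_add, map_add,
        TensorProduct.AlgebraTensorModule.cancelBaseChange_tmul, restrict_der, dAlg_der, der_smul,
        TensorProduct.add_tmul, add_assoc]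

variable [Algebra R R'] [Algebra R B'] [IsScalarTower R R' B'] [IsScalarTower R B B']
  [Algebra.IsPushout R R' B B']

/-- A tensor automorphism of the fibre functor on the category generated by `B' ⊗ M`, restricted
along `N ↦ B' ⊗ N` to the category generated by `M`. -/
def TensorAut.descend (c : QDRing.Compat D D') {p : Prop} {M : DMod D}
    (l : TensorAut S p (M.baseChange c)) : TensorAut S p M where
  app N hN := DMod.descend c N (l.app (N.baseChange c) (hN.baseChange c))
  natural {N N'} hN hN' f z := by
    obtain ⟨y, rfl⟩ := (cancelBaseChange B B' S S N).surjective z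
    rw [baseChange_cancelBaseChange, descend_cancelBaseChange, descend_cancelBaseChange,
      baseChange_cancelBaseChange]
    exact congrArg _ (l.natural _ _ (f.baseChange c) y)
  app_unit z := by
    obtain ⟨y, rfl⟩ := (cancelBaseChange B B' S S (DMod.unit D)).surjective z
    obtain ⟨x, rfl⟩ := LinearMap.lTensor_surjective S (rid B B' B').symm.surjective y
    rw [descend_cancelBaseChange]
    refine congrArg _ ((l.natural .unit _ (unitBaseChange c) x).trans ?_)
    rw [l.app_unit]
    rfl
  app_tensor {N N'} hN hN' z := by
    obtain ⟨y, rfl⟩ := (cancelBaseChange B B' S S (N.tensor N')).surjective z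
    rw [descend_cancelBaseChange, distribBaseChange_cancelBaseChange,
      distribBaseChange_cancelBaseChange]
    have app_comm_tensor := l.natural (Gen.baseChange c (.tensor hN hN'))
      (.tensor (hN.baseChange c) (hN'.baseChange c)) (baseChangeTensor c N N') y
    refine (congrArg _ (congrArg _ app_comm_tensor.symm)).trans ?_
    refine (congrArg _ (l.app_tensor (hN.baseChange c) (hN'.baseChange c) _)).trans ?_
    rw [← LinearMap.comp_apply, ← LinearMap.comp_apply, ← TensorProduct.map_comp,
      ← TensorProduct.map_comp]
    congr 2 <;> exact LinearMap.ext fun y => (descend_cancelBaseChange c _ _ y).symm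

theorem TensorAut.descend_delS (c : QDRing.Compat D D') {M : DMod D}
    (l : TensorAut S True (M.baseChange c)) (E : D'.DAlg S)
    (hl : ∀ (N : DMod D') (hN : Gen True (M.baseChange c) N) (z : S ⊗[B'] N),
      l.app N.prolong (.prolong trivial hN) (delS E N z) = delS E N (l.app N hN z))
    (N : DMod D) (hN : Gen True M N) (z : S ⊗[B] N) :
    (l.descend c).app N.prolong (.prolong trivial hN) (delS (E.restrict c) N z) =
      delS (E.restrict c) N ((l.descend c).app N hN z) := by
  obtain ⟨y, rfl⟩ := (cancelBaseChange B B' S S N).surjective z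
  calc DMod.descend c N.prolong (l.app _ _) (delS (E.restrict c) N (cancelBaseChange B B' S S N y))
    _ = DMod.descend c N.prolong (l.app _ _) (cancelBaseChange B B' S S N.prolong
          ((prolongBaseChange c N).toLin.baseChange S (delS E (N.baseChange c) y))) :=
      congrArg _ (cancelBaseChange_prolongBaseChange_delS c E N y).symm
    _ = cancelBaseChange B B' S S N.prolong ((prolongBaseChange c N).toLin.baseChange S
          (l.app _ (.prolong trivial (hN.baseChange c)) (delS E (N.baseChange c) y))) :=
      (descend_cancelBaseChange c _ _ _).trans (congrArg _ (l.natural _ _ _ _))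
    _ = delS (E.restrict c) N (cancelBaseChange B B' S S N (l.app _ (hN.baseChange c) y)) :=
      (congrArg _ (congrArg _ (hl _ _ y))).trans (cancelBaseChange_prolongBaseChange_delS c E N _)
    _ = delS (E.restrict c) N (DMod.descend c N (l.app _ _) (cancelBaseChange B B' S S N y)) :=
      congrArg _ (descend_cancelBaseChange c N _ y).symm

end Descent

end BaseChange

end DMod

theorem mainTheorem7_general {R R' : Type*} {B B' : Type u} [CommRing R] [CommRing R'] [CommRing B]
    [CommRing B'] [Algebra R R'] [Algebra R B] [Algebra R B'] [Algebra R' B'] [Algebra B B']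
    [IsScalarTower R R' B'] [IsScalarTower R B B'] [Algebra.IsPushout R R' B B']
    {D : QDRing R B} {D' : QDRing R' B'} (c : QDRing.Compat D D') (M : DMod D) :
    (∀ (S : Type w) [CommRing S] [Algebra B S] [Algebra B' S] [IsScalarTower B B' S],
      ∀ g ∈ DMod.Gal S (M.baseChange c), DMod.descend c M g ∈ DMod.Gal S M) ∧
    ∀ (S : Type w) [CommRing S] [Algebra B S] [Algebra B' S] [IsScalarTower B B' S]
      (E : D'.DAlg S),
      ∀ g ∈ DMod.GalDer E (M.baseChange c), DMod.descend c M g ∈ DMod.GalDer (E.restrict c) M := by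
  refine ⟨fun S _ _ _ _ g hg => ?_, fun S _ _ _ _ E g hg => ?_⟩
  · obtain ⟨l, rfl⟩ := hg
    exact ⟨l.descend c, rfl⟩
  · obtain ⟨l, rfl, l_comm_delS⟩ := hg
    exact ⟨l.descend c, rfl, l.descend_delS c E l_comm_delS⟩

namespace QDRing.Red

variable (R R' B : Type u) [CommRing R] [CommRing R'] [CommRing B] [Algebra R R'] [Algebra R B]

instance : Algebra R (Red R R' B) := inferInstanceAs (Algebra R (R' ⊗[R] B))

instance : IsScalarTower R R' (Red R R' B) := inferInstanceAs (IsScalarTower R R' (R' ⊗[R] B))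

attribute [local instance] Algebra.TensorProduct.rightAlgebra in
instance : IsScalarTower R B (Red R R' B) := inferInstanceAs (IsScalarTower R B (R' ⊗[R] B))

attribute [local instance] Algebra.TensorProduct.rightAlgebra in
instance : Algebra.IsPushout R R' B (Red R R' B) :=
  inferInstanceAs (Algebra.IsPushout R R' B (R' ⊗[R] B))

end QDRing.Red

end

theorem mainTheorem7 {k K : Type u} [Field k] [Field K] [Algebra k[X] K] [Algebra (RatFunc k) K]
    [IsScalarTower k[X] (RatFunc k) K] [FunctionField k K]
    (P : (FunctionField.ringOfIntegers k K)[X]) (hP : P ≠ 0)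
    (v : IsDedekindDomain.HeightOneSpectrum (FunctionField.ringOfIntegers k K))
    (hv : QSpec.q k K ∉ v.asIdeal)
    (M : DMod (QSpec.ringA P)) :
    (∀ (S : Type w) [CommRing S] [Algebra (QSpec.A P) S] [Algebra (QSpec.Av P v) S]
        [IsScalarTower (QSpec.A P) (QSpec.Av P v) S],
      ∀ g ∈ DMod.Gal S (QSpec.spec M v),
        DMod.descend (QSpec.compat P v) M g ∈ DMod.Gal S M) ∧
    (CharZero k →
      ∀ (S : Type w) [CommRing S] [Algebra (QSpec.A P) S] [Algebra (QSpec.Av P v) S]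
        [IsScalarTower (QSpec.A P) (QSpec.Av P v) S]
        (E : QDRing.DAlg ((QSpec.ringA P).red (QSpec.resField v)) S),
      ∀ g ∈ DMod.GalDer E (QSpec.spec M v),
        DMod.descend (QSpec.compat P v) M g ∈ DMod.GalDer (E.restrict (QSpec.compat P v)) M) :=
  (mainTheorem7_general (QSpec.compat P v) M).imp_right fun h _ => h
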